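/- All algebras have type $\langle \lor,\land,{}^*,{}',0,1\rangle$. An \emph{Almost Gautama algebra} is an algebra $\mathbf A=\langle A,\lor,\land,{}^*,{}',0,1\rangle$ such that $\langle A,\lor,\land,{}^*,0,1\rangle$ is a Stone algebra (a distributive pseudocomplemented lattice with $x^*\lor x^{**}\approx 1$); $\langle A,\lor,\land,{}',0,1\rangle$ is a dually quasi-De Morgan algebra (a bounded distributive lattice with $0'\approx 1$, $1'\approx 0$, $(x\land y)'\approx x'\lor y'$, $(x\lor y)''\approx x''\lor y''$ and $x''\le x$); and the identities $x\land x'{}^*{}'\le y\lor y^*$ (regularity), $x^*{}''\approx x^*$ and $(x\land x'{}^*)'{}^*\approx x\land x'{}^*$ hold. A \emph{Gautama algebra} satisfies the first two conditions, regularity, and $x^*{}'\approx x^{**}$. Let $\mathbb{AG}$ and $\mathbb G$ be the varieties of Almost Gautama and of Gautama algebras, and let $\mathbb V(\mathbf A_1,\dots,\mathbf A_n)$ be the variety generated by $\mathbf A_1,\dots,\mathbf A_n$. Let - $\mathbf 2$ be the two-element Boolean algebra, in which ${}^*$ and ${}'$ are both the complement; - $\mathbf{3_{dblst}}$ be the chain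 $0<a<1$ with $0^*=1$, $a^*=1^*=0$, $0'=a'=1$, $1'=0$; - $\mathbf{3_{klst}}$ be the chain $0<a<1$ with $0^*=1$, $a^*=1^*=0$, $0'=1$, $a'=a$, $1'=0$; - $\mathbf{4_{dmba}}$ be the four-element Boolean lattice $\{0,a,b,1\}$ in which ${}^*$ is the Boolean complement and $0'=1$, $1'=0$, $a'=a$, $b'=b$. A variety $\mathbb V$ has the \emph{Embedding Property} if for any two nontrivial (that is, having at least two elements) algebras $\mathbf A,\mathbf B\in\mathbb V$ there is an algebra $\mathbf C\in\mathbb V$ into which both $\mathbf A$ and $\mathbf B$ can be embedded. **Corollary.** (a) If $\mathbb V\in\{\mathbb V(\mathbf 2),\ \mathbb V(\mathbf{3_{dblst}}),\ \mathbb V(\mathbf{3_{klst}}),\ \mathbb V(\mathbf{4_{dmba}})\}$, then $\mathbb V$ has the Embedding Property. (b) If $\mathbb V\in\{\mathbb G,\ \mathbb V(\mathbf{3_{dblst}},\mathbf{4_{dmba}}),\ \mathbb V(\mathbf{3_{klst}},\mathbf{4_{dmba}}),\ \mathbb{AG}\}$, then $\mathbb V$ fails to have the Embedding Property. -/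

import Mathlib

universe u v

namespace AlmostGautama

/-- Operations of type `⟨∨, ∧, *, ', 0, 1⟩`, without any axioms: `⊔`, `⊓`, `pstar`, `prime`,
`⊥`, `⊤`. -/
class Ops (A : Type u) extends Max A, Min A, Bot A, Top A where
  /-- The unary operation `*`. -/
  pstar : A → A
  /-- The unary operation `'`. -/
  prime : A → A

open Ops

/-- An algebra of type `⟨∨, ∧, *, ', 0, 1⟩` (arbitrary operations on a set). -/
structure Alg : Type (u + 1) where
  carrier : Type u
  [ops : Ops carrier]

instance : CoeSort Alg.{u} (Type u) := ⟨Alg.carrier⟩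

instance (A : Alg.{u}) : Ops A := A.ops

/-- Homomorphisms of algebras of type `⟨∨, ∧, *, ', 0, 1⟩`. -/
structure IsHom {A : Type u} {B : Type v} [Ops A] [Ops B] (f : A → B) : Prop where
  map_sup : ∀ x y, f (x ⊔ y) = f x ⊔ f y
  map_inf : ∀ x y, f (x ⊓ y) = f x ⊓ f y
  map_pstar : ∀ x, f (pstar x) = pstar (f x)
  map_prime : ∀ x, f (prime x) = prime (f x)
  map_bot : f ⊥ = ⊥
  map_top : f ⊤ = ⊤

/-- `A` can be embedded in `B`: there is an injective homomorphism `A → B`. -/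
def Embeds (A B : Alg.{u}) : Prop :=
  ∃ f : A → B, IsHom f ∧ Function.Injective f

/-- `B` is a homomorphic image of `A`. -/
def IsHomImage (A B : Alg.{u}) : Prop :=
  ∃ f : A → B, IsHom f ∧ Function.Surjective f

/-- The direct product of a family of algebras, with coordinatewise operations. -/
def prod {I : Type u} (A : I → Alg.{u}) : Alg.{u} where
  carrier := ∀ i, A i
  ops :=
    { max := fun x y i => x i ⊔ y i
      min := fun x y i => x i ⊓ y i
      bot := fun _ => ⊥
      top := fun _ => ⊤
      pstar := fun x i => pstar (x i)
      prime := fun x i => prime (x i) }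

/-- A variety: a class of algebras closed under homomorphic images, (isomorphic copies of)
subalgebras and direct products. -/
structure IsVariety (K : Set Alg.{u}) : Prop where
  homImage : ∀ A B : Alg.{u}, A ∈ K → IsHomImage A B → B ∈ K
  subalgebra : ∀ A B : Alg.{u}, B ∈ K → Embeds A B → A ∈ K
  product : ∀ (I : Type u) (A : I → Alg.{u}), (∀ i, A i ∈ K) → prod A ∈ K

/-- The variety generated by a class `K`: the smallest variety that contains `K`. -/
def varietyGen (K : Set Alg.{u}) : Set Alg.{u} :=
  {A | ∀ W : Set Alg.{u}, IsVariety W → K ⊆ W → A ∈ W}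

/-- A variety has the Embedding Property if any two of its nontrivial algebras can be embedded
in a common member of the variety. -/
def EmbeddingProperty (V : Set Alg.{u}) : Prop :=
  ∀ A B : Alg.{u}, A ∈ V → B ∈ V → Nontrivial A → Nontrivial B →
    ∃ C : Alg.{u}, C ∈ V ∧ Embeds A C ∧ Embeds B C

/-! ### Almost Gautama algebras -/

/-- The order of a lattice, through its meet: `x ≤ y` iff `x ∧ y = x`. -/
def Below {A : Type u} [Ops A] (x y : A) : Prop := x ⊓ y = x

/-- `⟨A, ∨, ∧, 0, 1⟩` is a bounded distributive lattice. -/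
structure IsBoundedDistribLattice (A : Type u) [Ops A] : Prop where
  sup_comm : ∀ x y : A, x ⊔ y = y ⊔ x
  inf_comm : ∀ x y : A, x ⊓ y = y ⊓ x
  sup_assoc : ∀ x y z : A, x ⊔ y ⊔ z = x ⊔ (y ⊔ z)
  inf_assoc : ∀ x y z : A, x ⊓ y ⊓ z = x ⊓ (y ⊓ z)
  sup_inf_self : ∀ x y : A, x ⊔ x ⊓ y = x
  inf_sup_self : ∀ x y : A, x ⊓ (x ⊔ y) = x
  inf_sup_left : ∀ x y z : A, x ⊓ (y ⊔ z) = x ⊓ y ⊔ x ⊓ z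
  bot_below : ∀ x : A, Below ⊥ x
  below_top : ∀ x : A, Below x ⊤

/-- `⟨A, ∨, ∧, *, 0, 1⟩` is a distributive pseudocomplemented lattice satisfying the Stone
identity. -/
structure IsStoneAlgebra (A : Type u) [Ops A] : Prop extends IsBoundedDistribLattice A where
  pstar_bot : pstar (⊥ : A) = ⊤
  pstar_top : pstar (⊤ : A) = ⊥
  pstar_sup : ∀ x y : A, pstar (x ⊔ y) = pstar x ⊓ pstar y
  pstar_pstar_inf : ∀ x y : A, pstar (pstar (x ⊓ y)) = pstar (pstar x) ⊓ pstar (pstar y)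
  below_pstar_pstar : ∀ x : A, Below x (pstar (pstar x))
  pstar_inf_pstar_pstar : ∀ x : A, pstar x ⊓ pstar (pstar x) = ⊥
  stone : ∀ x : A, pstar x ⊔ pstar (pstar x) = ⊤

/-- `⟨A, ∨, ∧, ', 0, 1⟩` is a dually quasi-De Morgan algebra. -/
structure IsDuallyQuasiDeMorgan (A : Type u) [Ops A] : Prop
    extends IsBoundedDistribLattice A where
  prime_bot : prime (⊥ : A) = ⊤
  prime_top : prime (⊤ : A) = ⊥
  prime_inf : ∀ x y : A, prime (x ⊓ y) = prime x ⊔ prime y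
  prime_prime_sup : ∀ x y : A, prime (prime (x ⊔ y)) = prime (prime x) ⊔ prime (prime y)
  prime_prime_below : ∀ x : A, Below (prime (prime x)) x

/-- Regularity: `x ∧ x'*' ≤ y ∨ y*`. -/
def IsRegular (A : Type u) [Ops A] : Prop :=
  ∀ x y : A, Below (x ⊓ prime (pstar (prime x))) (y ⊔ pstar y)

/-- Gautama algebras. -/
structure IsGautama (A : Type u) [Ops A] : Prop where
  stoneAlgebra : IsStoneAlgebra A
  duallyQuasiDeMorgan : IsDuallyQuasiDeMorgan A
  regular : IsRegular A
  star_regular : ∀ x : A, prime (pstar x) = pstar (pstar x)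

/-- Almost Gautama algebras. -/
structure IsAlmostGautama (A : Type u) [Ops A] : Prop where
  stoneAlgebra : IsStoneAlgebra A
  duallyQuasiDeMorgan : IsDuallyQuasiDeMorgan A
  regular : IsRegular A
  weak_star_regular : ∀ x : A, prime (prime (pstar x)) = pstar x
  l1 : ∀ x : A, pstar (prime (x ⊓ pstar (prime x))) = x ⊓ pstar (prime x)

/-- The variety of Gautama algebras. -/
def varietyG : Set Alg.{u} := {A | IsGautama A}

/-- The variety of Almost Gautama algebras. -/
def varietyAG : Set Alg.{u} := {A | IsAlmostGautama A}

/-! ### The generating algebras -/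

/-- A copy of a small algebra in an arbitrary universe. -/
def Alg.lift (A : Alg.{0}) : Alg.{u} where
  carrier := ULift.{u} A
  ops :=
    { max := fun x y => ⟨x.down ⊔ y.down⟩
      min := fun x y => ⟨x.down ⊓ y.down⟩
      bot := ⟨⊥⟩
      top := ⟨⊤⟩
      pstar := fun x => ⟨pstar x.down⟩
      prime := fun x => ⟨prime x.down⟩ }

/-- Operations of the two-element Boolean algebra, where `*` and `'` are both the complement. -/
abbrev twoOps : Ops Bool where
  max := fun x y => x || y
  min := fun x y => x && y
  bot := false
  top := true
  pstar := fun x => !x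
  prime := fun x => !x

/-- The three-element chain `0 < 1 < 2` with `*` the pseudocomplement and `'` the dual
pseudocomplement. -/
abbrev threeDblstOps : Ops (Fin 3) where
  max := fun x y => max x y
  min := fun x y => min x y
  bot := 0
  top := 2
  pstar := ![2, 0, 0]
  prime := ![2, 2, 0]

/-- The three-element chain `0 < 1 < 2` with `*` the pseudocomplement and `'` the De Morgan
(Kleene) operation. -/
abbrev threeKlstOps : Ops (Fin 3) where
  max := fun x y => max x y
  min := fun x y => min x y
  bot := 0
  top := 2
  pstar := ![2, 0, 0]
  prime := ![2, 1, 0]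

/-- The four-element Boolean lattice with `*` the Boolean complement and `'` the De Morgan
operation that exchanges `0` and `1` and fixes both atoms `(1, 0)` and `(0, 1)`. -/
abbrev fourDmbaOps : Ops (Bool × Bool) where
  max := fun x y => (x.1 || y.1, x.2 || y.2)
  min := fun x y => (x.1 && y.1, x.2 && y.2)
  bot := (false, false)
  top := (true, true)
  pstar := fun x => (!x.1, !x.2)
  prime := fun x => (!x.2, !x.1)

/-- The algebra `2`. -/
def two : Alg.{u} := Alg.lift { carrier := Bool, ops := twoOps }

/-- The algebra `3_dblst`. -/
def threeDblst : Alg.{u} := Alg.lift { carrier := Fin 3, ops := threeDblstOps }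

/-- The algebra `3_klst`. -/
def threeKlst : Alg.{u} := Alg.lift { carrier := Fin 3, ops := threeKlstOps }

/-- The algebra `4_dmba`. -/
def fourDmba : Alg.{u} := Alg.lift { carrier := Bool × Bool, ops := fourDmbaOps }

end AlmostGautama

open AlmostGautama

/-! For (a), each of the four generators S is finite and has a discriminator-like term. An element x
is determined by x* and x'*', so `eqInd` compares these two through Boolean biconditionals. The
operation `box` then sends every value other than 1 to 0, which matters for the atoms of `fourDmba`.
The resulting `switch` makes each congruence on a subalgebra of a power of S come from a filter on
the index set. Extending that filter to an ultrafilter and using that S is finite yields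
homomorphisms to S that separate points of any quotient (`subPowers_homImage`). Hence every member
of V(S) embeds in a power of S, and two nontrivial members embed in powers with nonempty index sets
I and J, thus both in the power indexed by I × J.

For (b), two algebras of the variety are exhibited such that any member containing copies of both
satisfies 0 = 1. For the varieties with two generators, a term that vanishes identically on both
generators would take the value 1. For the Gautama and almost Gautama algebras, regularity is
incompatible with having the middle elements of both three-element chains. -/

namespace AlmostGautama

open Ops Filter

/-! ### The equality indicator -/

/-- The Boolean biconditional. -/
def biimp {A : Type u} [Ops A] (x y : A) : A := (x ⊓ y) ⊔ (pstar x ⊓ pstar y)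

/-- The term `x'*'`, which is the dual pseudocomplement in the generating algebras. -/
def dualStar {A : Type u} [Ops A] (x : A) : A := prime (pstar (prime x))

/-- The term `x ∧ x'*`. -/
def box {A : Type u} [Ops A] (x : A) : A := x ⊓ pstar (prime x)

/-- A binary term which, in the generating algebras, is `1` if `x = y` and `0` otherwise. -/
def eqInd {A : Type u} [Ops A] (x y : A) : A :=
  box (biimp (pstar x) (pstar y) ⊓ biimp (dualStar x) (dualStar y))

/-- A quaternary term which, in the generating algebras, is `z` if `x = y` and `w` otherwise. -/
def switch {A : Type u} [Ops A] (x y z w : A) : A :=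
  (eqInd x y ⊓ z) ⊔ (pstar (eqInd x y) ⊓ w)

section Hom

variable {A : Type u} {B : Type v} [Ops A] [Ops B] {f : A → B}

theorem IsHom.map_eqInd (hf : IsHom f) (x y : A) : f (eqInd x y) = eqInd (f x) (f y) := by
  simp only [eqInd, box, biimp, dualStar, hf.map_sup, hf.map_inf, hf.map_pstar, hf.map_prime]

theorem IsHom.map_switch (hf : IsHom f) (x y z w : A) :
    f (switch x y z w) = switch (f x) (f y) (f z) (f w) := by
  simp only [switch, hf.map_eqInd, hf.map_sup, hf.map_inf, hf.map_pstar]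

theorem IsHom.comp {C : Type*} [Ops C] {g : B → C} (hg : IsHom g) (hf : IsHom f) :
    IsHom (g ∘ f) where
  map_sup x y := by simp [hf.map_sup, hg.map_sup]
  map_inf x y := by simp [hf.map_inf, hg.map_inf]
  map_pstar x := by simp [hf.map_pstar, hg.map_pstar]
  map_prime x := by simp [hf.map_prime, hg.map_prime]
  map_bot := by simp [hf.map_bot, hg.map_bot]
  map_top := by simp [hf.map_top, hg.map_top]

end Hom

theorem isHom_proj {I : Type u} (A : I → Alg.{u}) (i : I) :
    IsHom (fun x : prod A => (x i : A i)) :=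
  ⟨fun _ _ => rfl, fun _ _ => rfl, fun _ => rfl, fun _ => rfl, rfl, rfl⟩

theorem isHom_prod {I : Type u} {A : I → Alg.{u}} {B : Alg.{u}} {f : B → prod A}
    (hf : ∀ i, IsHom (fun x => (f x i : A i))) : IsHom f where
  map_sup x y := funext fun i => (hf i).map_sup x y
  map_inf x y := funext fun i => (hf i).map_inf x y
  map_pstar x := funext fun i => (hf i).map_pstar x
  map_prime x := funext fun i => (hf i).map_prime x
  map_bot := funext fun i => (hf i).map_bot
  map_top := funext fun i => (hf i).map_top

theorem Embeds.trans {A B C : Alg.{u}} (h₁ : Embeds A B) (h₂ : Embeds B C) : Embeds A C := by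
  obtain ⟨f, hf, hfi⟩ := h₁
  obtain ⟨g, hg, hgi⟩ := h₂
  exact ⟨g ∘ f, hg.comp hf, hgi.comp hfi⟩

/-! ### Varieties generated by a finite algebra with an equality indicator -/

/-- `eqInd` is the characteristic function of equality, and `switch` the switching function. -/
structure HasEqInd (A : Type u) [Ops A] : Prop where
  finite : Finite A
  eqInd_self : ∀ x : A, eqInd x x = ⊤
  eq_of_eqInd : ∀ x y : A, eqInd x y = ⊤ → x = y
  switch_self : ∀ x z w : A, switch x x z w = z
  switch_of_ne : ∀ x y z w : A, x ≠ y → switch x y z w = w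
  inf_eq_top : ∀ x y : A, x ⊓ y = ⊤ ↔ x = ⊤ ∧ y = ⊤

theorem HasEqInd.lift {A : Alg.{0}} (h : HasEqInd A) : HasEqInd (Alg.lift.{u} A) where
  finite :=
    have := h.finite
    (inferInstance : Finite (ULift.{u} A.carrier))
  eqInd_self := fun ⟨x⟩ => congrArg ULift.up (h.eqInd_self x)
  eq_of_eqInd := fun ⟨x⟩ ⟨y⟩ e => congrArg ULift.up (h.eq_of_eqInd x y (congrArg ULift.down e))
  switch_self := fun ⟨x⟩ ⟨z⟩ ⟨w⟩ => congrArg ULift.up (h.switch_self x z w)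
  switch_of_ne := fun ⟨x⟩ ⟨y⟩ ⟨z⟩ ⟨w⟩ hne =>
    congrArg ULift.up (h.switch_of_ne x y z w fun e => hne (congrArg ULift.up e))
  inf_eq_top := fun ⟨x⟩ ⟨y⟩ =>
    ⟨fun e => ((h.inf_eq_top x y).1 (congrArg ULift.down e)).imp
        (congrArg ULift.up) (congrArg ULift.up),
      fun e => congrArg ULift.up ((h.inf_eq_top x y).2
        (e.imp (congrArg ULift.down) (congrArg ULift.down)))⟩

/-- The algebras that embed in a power of `S`. -/
def subPowers (S : Alg.{u}) : Set Alg.{u} :=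
  {A | ∃ I : Type u, Embeds A (prod fun _ : I => S)}

theorem mem_subPowers_of_separating {S A : Alg.{u}}
    (h : ∀ a b : A, a ≠ b → ∃ f : A → S, IsHom f ∧ f a ≠ f b) : A ∈ subPowers S := by
  refine ⟨{f : A → S // IsHom f}, fun a f => f.1 a, isHom_prod fun f => f.2, fun a b hab => ?_⟩
  by_contra hne
  obtain ⟨f, hf, hfab⟩ := h a b hne
  exact hfab (congrFun hab ⟨f, hf⟩)

/-- A homomorphism to an ultrapower of a finite algebra is a homomorphism to the algebra. -/
theorem exists_isHom_ultrafilter {S A : Alg.{u}} [Finite S] {I : Type u}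
    {g : A → prod fun _ : I => S} (hg : IsHom g) (U : Ultrafilter I) :
    ∃ s : A → S, IsHom s ∧ ∀ x, ∀ᶠ i in U, g x i = s x := by
  have hex : ∀ x : A, ∃ s : S, ∀ᶠ i in U, g x i = s := by
    intro x
    -- An ultrafilter on the finite set S is principal; its point is the value of the limit at x.
    obtain ⟨s, hs⟩ := Ultrafilter.eq_pure_of_finite (U.map fun i => (g x i : S))
    refine ⟨s, ?_⟩
    have hmem : ({s} : Set S) ∈ U.map fun i => (g x i : S) := by rw [hs]; exact rfl
    exact hmem
  choose s hs using hex
  have key : ∀ (x : A) (t : S), (∀ᶠ i in U, g x i = t) → s x = t := by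
    intro x t ht
    obtain ⟨i, hi, hi'⟩ := ((hs x).and ht).exists
    exact hi.symm.trans hi'
  have hgi (i : I) : IsHom fun x => (g x i : S) := (isHom_proj _ i).comp hg
  refine ⟨s, ⟨fun x y => key _ _ ?_, fun x y => key _ _ ?_, fun x => key _ _ ?_,
    fun x => key _ _ ?_, key _ _ ?_, key _ _ ?_⟩, hs⟩
  · filter_upwards [hs x, hs y] with i hx hy
    rw [← hx, ← hy]; exact (hgi i).map_sup x y
  · filter_upwards [hs x, hs y] with i hx hy
    rw [← hx, ← hy]; exact (hgi i).map_inf x y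
  · filter_upwards [hs x] with i hx
    rw [← hx]; exact (hgi i).map_pstar x
  · filter_upwards [hs x] with i hx
    rw [← hx]; exact (hgi i).map_prime x
  · exact Eventually.of_forall fun i => (hgi i).map_bot
  · exact Eventually.of_forall fun i => (hgi i).map_top

/-- Two elements of A have the same image in B exactly when the set of coordinates where they agree
lies in the filter F below. An ultrafilter finer than F therefore gives a homomorphism A → S that
factors through B. -/
theorem subPowers_homImage {S : Alg.{u}} (hS : HasEqInd S) {A B : Alg.{u}}
    (hA : A ∈ subPowers S) (hAB : IsHomImage A B) : B ∈ subPowers S := by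
  have := hS.finite
  obtain ⟨I, g, hg, hgi⟩ := hA
  obtain ⟨f, hf, hfs⟩ := hAB
  have hgI (i : I) : IsHom fun x => (g x i : S) := (isHom_proj _ i).comp hg
  have ext {x y : A} (h : ∀ i, (g x i : S) = g y i) : x = y := hgi (funext h)
  -- A carries no axioms of its own, so even these identities are read off coordinatewise in S.
  have eqInd_self (x : A) : eqInd x x = ⊤ := ext fun i =>
    ((hgI i).map_eqInd x x).trans ((hS.eqInd_self _).trans (hgI i).map_top.symm)
  have top_inf : (⊤ : A) ⊓ ⊤ = ⊤ := ext fun i => ((hgI i).map_inf _ _).trans <|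
    ((hS.inf_eq_top _ _).2 ⟨(hgI i).map_top, (hgI i).map_top⟩).trans (hgI i).map_top.symm
  -- a pair identified where `u = ⊤`, with `u` in the kernel class of `⊤`, is in the kernel
  have kernel {u a b : A} (hu : f u = f ⊤) (h : ∀ i, (g u i : S) = ⊤ → (g a i : S) = g b i) :
      f a = f b := by
    have h₁ : switch u ⊤ a b = b := ext fun i => by
      refine ((hgI i).map_switch _ _ _ _).trans ?_
      have ht : (g ⊤ i : S) = ⊤ := (hgI i).map_top
      by_cases hi : (g u i : S) = ⊤
      · exact (by rw [ht, hi]; exact (hS.switch_self _ _ _).trans (h i hi))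
      · exact hS.switch_of_ne _ _ _ _ (by rw [ht]; exact hi)
    have h₂ : switch (⊤ : A) ⊤ a b = a := ext fun i =>
      ((hgI i).map_switch _ _ _ _).trans (hS.switch_self _ _ _)
    calc f a = f (switch ⊤ ⊤ a b) := by rw [h₂]
      _ = f (switch u ⊤ a b) := by rw [hf.map_switch, hf.map_switch, hu]
      _ = f b := by rw [h₁]
  -- F is generated by the sets {i : u i = 1} with u congruent to 1. Meets in A give intersections
  -- of these sets.
  let F : Filter I :=
    { sets := {X | ∃ u : A, f u = f ⊤ ∧ ∀ i, (g u i : S) = ⊤ → i ∈ X}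
      univ_sets := ⟨⊤, rfl, fun _ _ => trivial⟩
      sets_of_superset := fun ⟨u, hu, h⟩ hXY => ⟨u, hu, fun i hi => hXY (h i hi)⟩
      inter_sets := by
        rintro X Y ⟨u, hu, hX⟩ ⟨w, hw, hY⟩
        refine ⟨u ⊓ w, ?_, fun i hi => ?_⟩
        · rw [hf.map_inf, hu, hw, ← hf.map_inf, top_inf]
        · have := (hS.inf_eq_top _ _).1 (((hgI i).map_inf u w).symm.trans hi)
          exact ⟨hX i this.1, hY i this.2⟩ }
  refine mem_subPowers_of_separating fun p q hpq => ?_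
  obtain ⟨a, rfl⟩ := hfs p
  obtain ⟨b, rfl⟩ := hfs q
  -- Since f a ≠ f b, `kernel` keeps the agreement set of a and b out of F, so some ultrafilter
  -- above F contains its complement.
  have hne : (F ⊓ 𝓟 {i | (g a i : S) = g b i}ᶜ).NeBot := by
    rw [← Filter.notMem_iff_inf_principal_compl]
    rintro ⟨u, hu, h⟩
    exact hpq (kernel hu h)
  let U : Ultrafilter I := Ultrafilter.of (F ⊓ 𝓟 {i | (g a i : S) = g b i}ᶜ)
  have hU : (U : Filter I) ≤ F ⊓ 𝓟 {i | (g a i : S) = g b i}ᶜ := Ultrafilter.of_le _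
  obtain ⟨s, hs, hsU⟩ := exists_isHom_ultrafilter hg U
  have hker {x y : A} (hxy : f x = f y) : s x = s y := by
    have hmem : {i | (g x i : S) = g y i} ∈ F := by
      -- If f x = f y, then `eqInd x y` is congruent to `eqInd x x` = 1, and it equals 1 only at
      -- coordinates where x and y agree.
      refine ⟨eqInd x y, ?_, fun i hi => hS.eq_of_eqInd _ _ (((hgI i).map_eqInd x y).symm.trans hi)⟩
      rw [hf.map_eqInd, ← hxy, ← hf.map_eqInd, eqInd_self]
    have hev : ∀ᶠ i in (U : Filter I), (g x i : S) = g y i := (hU.trans inf_le_left) hmem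
    obtain ⟨i, ⟨hi, hx⟩, hy⟩ := ((hev.and (hsU x)).and (hsU y)).exists
    exact hx.symm.trans (hi.trans hy)
  have hinv (x : A) : s (Function.surjInv hfs (f x)) = s x :=
    hker (Function.surjInv_eq hfs (f x))
  refine ⟨fun z => s (Function.surjInv hfs z), ⟨?_, ?_, ?_, ?_, ?_, ?_⟩, ?_⟩
  · intro x y
    obtain ⟨x, rfl⟩ := hfs x
    obtain ⟨y, rfl⟩ := hfs y
    rw [← hf.map_sup, hinv, hinv, hinv, hs.map_sup]
  · intro x y
    obtain ⟨x, rfl⟩ := hfs x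
    obtain ⟨y, rfl⟩ := hfs y
    rw [← hf.map_inf, hinv, hinv, hinv, hs.map_inf]
  · intro x
    obtain ⟨x, rfl⟩ := hfs x
    rw [← hf.map_pstar, hinv, hinv, hs.map_pstar]
  · intro x
    obtain ⟨x, rfl⟩ := hfs x
    rw [← hf.map_prime, hinv, hinv, hs.map_prime]
  · rw [← hf.map_bot, hinv, hs.map_bot]
  · rw [← hf.map_top, hinv, hs.map_top]
  · beta_reduce
    rw [hinv, hinv]
    intro hab
    have hev : ∀ᶠ i in (U : Filter I), (g a i : S) ≠ g b i :=
      (hU.trans inf_le_right) (mem_principal_self _)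
    obtain ⟨i, ⟨hi, ha⟩, hb⟩ := ((hev.and (hsU a)).and (hsU b)).exists
    exact hi (ha.trans (hab.trans hb.symm))

theorem isVariety_subPowers {S : Alg.{u}} (hS : HasEqInd S) : IsVariety (subPowers S) where
  homImage _ _ := subPowers_homImage hS
  subalgebra := fun _ _ ⟨I, hI⟩ hAB => ⟨I, hAB.trans hI⟩
  product I A h := by
    refine mem_subPowers_of_separating fun a b hab => ?_
    obtain ⟨i, hi⟩ := Function.ne_iff.1 hab
    obtain ⟨J, g, hg, hgi⟩ := h i
    obtain ⟨j, hj⟩ := Function.ne_iff.1 (hgi.ne hi)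
    exact ⟨_, (isHom_proj _ j).comp (hg.comp (isHom_proj A i)), hj⟩

theorem self_mem_subPowers (S : Alg.{u}) : S ∈ subPowers S :=
  mem_subPowers_of_separating fun _ _ h =>
    ⟨id, ⟨fun _ _ => rfl, fun _ _ => rfl, fun _ => rfl, fun _ => rfl, rfl, rfl⟩, h⟩

theorem varietyGen_subset_subPowers {S : Alg.{u}} (hS : HasEqInd S) :
    varietyGen {S} ⊆ subPowers S := fun _ hA =>
  hA _ (isVariety_subPowers hS) (Set.singleton_subset_iff.2 (self_mem_subPowers S))

/-! ### Joint embedding in a common power -/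

theorem embeds_power_of_surjective (S : Alg.{u}) {I J : Type u} {p : J → I}
    (hp : Function.Surjective p) :
    Embeds (prod fun _ : I => S) (prod fun _ : J => S) :=
  ⟨fun x j => x (p j), isHom_prod fun j => isHom_proj _ (p j), hp.injective_comp_right⟩

theorem nonempty_of_embeds_prod {A : Alg.{u}} [Nontrivial A] {I : Type u} {B : I → Alg.{u}}
    (h : Embeds A (prod B)) : Nonempty I := by
  obtain ⟨f, -, hf⟩ := h
  obtain ⟨x, y, hxy⟩ := exists_pair_ne A
  obtain ⟨i, -⟩ := Function.ne_iff.1 (hf.ne hxy)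
  exact ⟨i⟩

/-- Nontriviality makes both index sets nonempty, which is what makes the two projections of I × J
surjective. -/
theorem embeddingProperty_varietyGen_singleton {S : Alg.{u}} (hS : HasEqInd S) :
    EmbeddingProperty (varietyGen {S}) := by
  intro A B hA hB _ _
  obtain ⟨I, hI⟩ := varietyGen_subset_subPowers hS hA
  obtain ⟨J, hJ⟩ := varietyGen_subset_subPowers hS hB
  have := nonempty_of_embeds_prod hI
  have := nonempty_of_embeds_prod hJ
  exact ⟨prod fun _ : I × J => S, fun W hW hSW => hW.product _ _ fun _ => hSW rfl,
    hI.trans (embeds_power_of_surjective S Prod.fst_surjective),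
    hJ.trans (embeds_power_of_surjective S Prod.snd_surjective)⟩

theorem hasEqInd_two : HasEqInd two.{u} :=
  HasEqInd.lift (A := { carrier := Bool, ops := twoOps })
    (@HasEqInd.mk Bool twoOps inferInstance (by decide) (by decide) (by decide) (by decide)
      (by decide))

theorem hasEqInd_threeDblst : HasEqInd threeDblst.{u} :=
  HasEqInd.lift (A := { carrier := Fin 3, ops := threeDblstOps })
    (@HasEqInd.mk (Fin 3) threeDblstOps inferInstance (by decide) (by decide) (by decide)
      (by decide) (by decide))

theorem hasEqInd_threeKlst : HasEqInd threeKlst.{u} :=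
  HasEqInd.lift (A := { carrier := Fin 3, ops := threeKlstOps })
    (@HasEqInd.mk (Fin 3) threeKlstOps inferInstance (by decide) (by decide) (by decide)
      (by decide) (by decide))

theorem hasEqInd_fourDmba : HasEqInd fourDmba.{u} :=
  HasEqInd.lift (A := { carrier := Bool × Bool, ops := fourDmbaOps })
    (@HasEqInd.mk (Bool × Bool) fourDmbaOps inferInstance (by decide) (by decide) (by decide)
      (by decide) (by decide))

/-! ### Identities -/

/-- A binary operation on all algebras that is preserved by all homomorphisms. -/
def IsNatural (p : ∀ A : Alg.{u}, A → A → A) : Prop :=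
  ∀ (A B : Alg.{u}) (f : A → B), IsHom f → ∀ x y, f (p A x y) = p B (f x) (f y)

/-- Commuting with homomorphisms is the only property of terms needed for an identity to pass to
images, subalgebras and products, so no syntax of terms is required. -/
theorem isVariety_identity {p q : ∀ A : Alg.{u}, A → A → A} (hp : IsNatural p)
    (hq : IsNatural q) : IsVariety {A | ∀ x y, p A x y = q A x y} where
  homImage := by
    rintro A B hA ⟨f, hf, hfs⟩ x y
    obtain ⟨x, rfl⟩ := hfs x
    obtain ⟨y, rfl⟩ := hfs y
    rw [← hp _ _ f hf, ← hq _ _ f hf, hA]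
  subalgebra := by
    rintro A B hB ⟨f, hf, hfi⟩ x y
    apply hfi
    rw [hp _ _ f hf, hq _ _ f hf, hB]
  product I A hA x y := funext fun i =>
    (hp _ _ _ (isHom_proj A i) x y).trans
      ((hA i (x i) (y i)).trans (hq _ _ _ (isHom_proj A i) x y).symm)

theorem identity_of_mem_varietyGen {p q : ∀ A : Alg.{u}, A → A → A} (hp : IsNatural p)
    (hq : IsNatural q) {K : Set Alg.{u}} (hK : ∀ A ∈ K, ∀ x y, p A x y = q A x y) {A : Alg.{u}}
    (hA : A ∈ varietyGen K) (x y : A) : p A x y = q A x y :=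
  hA _ (isVariety_identity hp hq) hK x y

theorem subset_varietyGen (K : Set Alg.{u}) : K ⊆ varietyGen K := fun _ hA _ _ hK => hK hA

theorem isNatural_top : IsNatural.{u} fun _ _ _ => ⊤ := fun _ _ _ hf _ _ => hf.map_top

theorem isNatural_bot : IsNatural.{u} fun _ _ _ => ⊥ := fun _ _ _ hf _ _ => hf.map_bot

section EqInd

variable {K : Set Alg.{u}} {C : Alg.{u}}

theorem eqInd_self_of_mem_varietyGen (hK : ∀ A ∈ K, HasEqInd A) (hC : C ∈ varietyGen K) (x : C) :
    eqInd x x = ⊤ :=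
  identity_of_mem_varietyGen (p := fun _ x _ => eqInd x x) (fun _ _ _ hf _ _ => hf.map_eqInd _ _)
    isNatural_top (fun A hA x _ => (hK A hA).eqInd_self x) hC x x

theorem top_inf_top_of_mem_varietyGen (hK : ∀ A ∈ K, HasEqInd A) (hC : C ∈ varietyGen K) :
    (⊤ : C) ⊓ ⊤ = ⊤ :=
  identity_of_mem_varietyGen (p := fun _ _ _ => ⊤ ⊓ ⊤)
    (fun _ _ _ hf _ _ => by rw [hf.map_inf, hf.map_top])
    isNatural_top (fun A hA _ _ => ((hK A hA).inf_eq_top _ _).2 ⟨rfl, rfl⟩) hC ⊤ ⊤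

end EqInd

/-! ### Failure for the varieties with two generators -/

theorem hasEqInd_of_mem_pair {S T : Alg.{u}} (hS : HasEqInd S) (hT : HasEqInd T) :
    ∀ A ∈ ({S, T} : Set Alg.{u}), HasEqInd A := by
  rintro A (rfl | rfl)
  exacts [hS, hT]

theorem bot_ne_top_of_embeds {A C : Alg.{u}} (hA : (⊥ : A) ≠ ⊤) (h : Embeds A C) :
    (⊥ : C) ≠ ⊤ := by
  obtain ⟨f, hf, hfi⟩ := h
  rw [← hf.map_bot, ← hf.map_top]
  exact hfi.ne hA

theorem threeDblst_bot_ne_top : (⊥ : threeDblst.{u}) ≠ ⊤ := fun h =>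
  absurd (congrArg ULift.down h : (0 : Fin 3) = 2) (by decide)

theorem threeKlst_bot_ne_top : (⊥ : threeKlst.{u}) ≠ ⊤ := fun h =>
  absurd (congrArg ULift.down h : (0 : Fin 3) = 2) (by decide)

theorem fourDmba_bot_ne_top : (⊥ : fourDmba.{u}) ≠ ⊤ := fun h =>
  absurd (congrArg ULift.down h : (false, false) = (true, true)) (by decide)

instance : Nontrivial threeDblst.{u} := ⟨⊥, ⊤, threeDblst_bot_ne_top⟩

instance : Nontrivial threeKlst.{u} := ⟨⊥, ⊤, threeKlst_bot_ne_top⟩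

instance : Nontrivial fourDmba.{u} := ⟨⊥, ⊤, fourDmba_bot_ne_top⟩

/-- `⊤` iff `x' = 1`, `x* = 0` and `y' = y`. -/
def dblstDmbaTerm {A : Type u} [Ops A] (x y : A) : A :=
  (eqInd (prime x) ⊤ ⊓ eqInd (pstar x) ⊥) ⊓ eqInd (prime y) y

/-- `⊤` iff `x' = x`, `x* = 0`, `y' = y` and `y*' = y*`. -/
def klstDmbaTerm {A : Type u} [Ops A] (x y : A) : A :=
  (eqInd (prime x) x ⊓ eqInd (pstar x) ⊥) ⊓
    (eqInd (prime y) y ⊓ eqInd (prime (pstar y)) (pstar y))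

/-- In `threeDblst` the operation ' has no fixed point; in `fourDmba`, x* = 0 forces x = 1, and then
x' = 0. -/
theorem dblstDmbaTerm_eq_bot : ∀ A ∈ ({threeDblst, fourDmba} : Set Alg.{u}), ∀ x y : A,
    dblstDmbaTerm x y = ⊥ := by
  rintro A (rfl | rfl) ⟨x⟩ ⟨y⟩
  · exact congrArg ULift.up ((by decide : ∀ x y : Fin 3,
      @dblstDmbaTerm _ threeDblstOps x y = (0 : Fin 3)) x y)
  · exact congrArg ULift.up ((by decide : ∀ x y : Bool × Bool,
      @dblstDmbaTerm _ fourDmbaOps x y = (false, false)) x y)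

/-- In `threeKlst` the only fixed point of ' is the middle element, whose * is 0 and hence not
fixed; in `fourDmba`, x* = 0 forces x = 1, which is not fixed. -/
theorem klstDmbaTerm_eq_bot : ∀ A ∈ ({threeKlst, fourDmba} : Set Alg.{u}), ∀ x y : A,
    klstDmbaTerm x y = ⊥ := by
  rintro A (rfl | rfl) ⟨x⟩ ⟨y⟩
  · exact congrArg ULift.up ((by decide : ∀ x y : Fin 3,
      @klstDmbaTerm _ threeKlstOps x y = (0 : Fin 3)) x y)
  · exact congrArg ULift.up ((by decide : ∀ x y : Bool × Bool,
      @klstDmbaTerm _ fourDmbaOps x y = (false, false)) x y)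

theorem not_embeddingProperty_threeDblst_fourDmba :
    ¬ EmbeddingProperty (varietyGen {threeDblst.{u}, fourDmba}) := by
  intro h
  obtain ⟨C, hC, hAC, hBC⟩ := h threeDblst fourDmba (subset_varietyGen _ (by simp))
    (subset_varietyGen _ (by simp)) inferInstance inferInstance
  have hK := hasEqInd_of_mem_pair hasEqInd_threeDblst.{u} hasEqInd_fourDmba
  apply bot_ne_top_of_embeds threeDblst_bot_ne_top hAC
  obtain ⟨f, hf, -⟩ := hAC
  obtain ⟨g, hg, -⟩ := hBC
  let a : threeDblst.{u} := ⟨(1 : Fin 3)⟩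
  let b : fourDmba.{u} := ⟨(true, false)⟩
  have ha₁ : prime (f a) = ⊤ := by rw [← hf.map_prime, ← hf.map_top]; rfl
  have ha₂ : pstar (f a) = ⊥ := by rw [← hf.map_pstar, ← hf.map_bot]; rfl
  have hb₁ : prime (g b) = g b := by rw [← hg.map_prime]; rfl
  have key := identity_of_mem_varietyGen (p := fun _ x y => dblstDmbaTerm x y)
    (fun _ _ _ hf _ _ => by
      simp only [dblstDmbaTerm, hf.map_eqInd, hf.map_inf, hf.map_pstar, hf.map_prime, hf.map_top,
        hf.map_bot])
    isNatural_bot dblstDmbaTerm_eq_bot hC (f a) (g b)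
  simp only [dblstDmbaTerm, ha₁, ha₂, hb₁, eqInd_self_of_mem_varietyGen hK hC,
    top_inf_top_of_mem_varietyGen hK hC] at key
  exact key.symm

theorem not_embeddingProperty_threeKlst_fourDmba :
    ¬ EmbeddingProperty (varietyGen {threeKlst.{u}, fourDmba}) := by
  intro h
  obtain ⟨C, hC, hAC, hBC⟩ := h threeKlst fourDmba (subset_varietyGen _ (by simp))
    (subset_varietyGen _ (by simp)) inferInstance inferInstance
  have hK := hasEqInd_of_mem_pair hasEqInd_threeKlst.{u} hasEqInd_fourDmba
  apply bot_ne_top_of_embeds threeKlst_bot_ne_top hAC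
  obtain ⟨f, hf, -⟩ := hAC
  obtain ⟨g, hg, -⟩ := hBC
  let a : threeKlst.{u} := ⟨(1 : Fin 3)⟩
  let b : fourDmba.{u} := ⟨(true, false)⟩
  have ha₁ : prime (f a) = f a := by rw [← hf.map_prime]; rfl
  have ha₂ : pstar (f a) = ⊥ := by rw [← hf.map_pstar, ← hf.map_bot]; rfl
  have hb₁ : prime (g b) = g b := by rw [← hg.map_prime]; rfl
  have hb₂ : prime (pstar (g b)) = pstar (g b) := by
    rw [← hg.map_pstar, ← hg.map_prime]; rfl
  have key := identity_of_mem_varietyGen (p := fun _ x y => klstDmbaTerm x y)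
    (fun _ _ _ hf _ _ => by
      simp only [klstDmbaTerm, hf.map_eqInd, hf.map_inf, hf.map_pstar, hf.map_prime, hf.map_bot])
    isNatural_bot klstDmbaTerm_eq_bot hC (f a) (g b)
  simp only [klstDmbaTerm, ha₁, ha₂, hb₁, hb₂, eqInd_self_of_mem_varietyGen hK hC,
    top_inf_top_of_mem_varietyGen hK hC] at key
  exact key.symm

/-! ### Gautama and almost Gautama algebras -/

section Lift

variable {A : Alg.{0}}

theorem IsBoundedDistribLattice.lift (h : IsBoundedDistribLattice A) :
    IsBoundedDistribLattice (Alg.lift.{u} A) where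
  sup_comm := fun ⟨x⟩ ⟨y⟩ => congrArg ULift.up (h.sup_comm x y)
  inf_comm := fun ⟨x⟩ ⟨y⟩ => congrArg ULift.up (h.inf_comm x y)
  sup_assoc := fun ⟨x⟩ ⟨y⟩ ⟨z⟩ => congrArg ULift.up (h.sup_assoc x y z)
  inf_assoc := fun ⟨x⟩ ⟨y⟩ ⟨z⟩ => congrArg ULift.up (h.inf_assoc x y z)
  sup_inf_self := fun ⟨x⟩ ⟨y⟩ => congrArg ULift.up (h.sup_inf_self x y)
  inf_sup_self := fun ⟨x⟩ ⟨y⟩ => congrArg ULift.up (h.inf_sup_self x y)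
  inf_sup_left := fun ⟨x⟩ ⟨y⟩ ⟨z⟩ => congrArg ULift.up (h.inf_sup_left x y z)
  bot_below := fun ⟨x⟩ => congrArg ULift.up (h.bot_below x)
  below_top := fun ⟨x⟩ => congrArg ULift.up (h.below_top x)

theorem IsStoneAlgebra.lift (h : IsStoneAlgebra A) : IsStoneAlgebra (Alg.lift.{u} A) where
  toIsBoundedDistribLattice := h.toIsBoundedDistribLattice.lift
  pstar_bot := congrArg ULift.up h.pstar_bot
  pstar_top := congrArg ULift.up h.pstar_top
  pstar_sup := fun ⟨x⟩ ⟨y⟩ => congrArg ULift.up (h.pstar_sup x y)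
  pstar_pstar_inf := fun ⟨x⟩ ⟨y⟩ => congrArg ULift.up (h.pstar_pstar_inf x y)
  below_pstar_pstar := fun ⟨x⟩ => congrArg ULift.up (h.below_pstar_pstar x)
  pstar_inf_pstar_pstar := fun ⟨x⟩ => congrArg ULift.up (h.pstar_inf_pstar_pstar x)
  stone := fun ⟨x⟩ => congrArg ULift.up (h.stone x)

theorem IsDuallyQuasiDeMorgan.lift (h : IsDuallyQuasiDeMorgan A) :
    IsDuallyQuasiDeMorgan (Alg.lift.{u} A) where
  toIsBoundedDistribLattice := h.toIsBoundedDistribLattice.lift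
  prime_bot := congrArg ULift.up h.prime_bot
  prime_top := congrArg ULift.up h.prime_top
  prime_inf := fun ⟨x⟩ ⟨y⟩ => congrArg ULift.up (h.prime_inf x y)
  prime_prime_sup := fun ⟨x⟩ ⟨y⟩ => congrArg ULift.up (h.prime_prime_sup x y)
  prime_prime_below := fun ⟨x⟩ => congrArg ULift.up (h.prime_prime_below x)

theorem IsGautama.lift (h : IsGautama A) : IsGautama (Alg.lift.{u} A) where
  stoneAlgebra := h.stoneAlgebra.lift
  duallyQuasiDeMorgan := h.duallyQuasiDeMorgan.lift
  regular := fun ⟨x⟩ ⟨y⟩ => congrArg ULift.up (h.regular x y)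
  star_regular := fun ⟨x⟩ => congrArg ULift.up (h.star_regular x)

end Lift

theorem isGautama_threeDblst : IsGautama threeDblst.{u} := by
  refine IsGautama.lift (A := { carrier := Fin 3, ops := threeDblstOps }) ?_
  let _ := threeDblstOps
  have hL : IsBoundedDistribLattice (Fin 3) := by
    constructor <;> (try unfold Below) <;> decide
  refine @IsGautama.mk (Fin 3) _ (@IsStoneAlgebra.mk _ _ hL ?_ ?_ ?_ ?_ ?_ ?_ ?_)
    (@IsDuallyQuasiDeMorgan.mk _ _ hL ?_ ?_ ?_ ?_ ?_) ?_ ?_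
  all_goals try unfold IsRegular
  all_goals try unfold Below
  all_goals decide

theorem isAlmostGautama_threeDblst : IsAlmostGautama threeDblst.{u} where
  stoneAlgebra := isGautama_threeDblst.stoneAlgebra
  duallyQuasiDeMorgan := isGautama_threeDblst.duallyQuasiDeMorgan
  regular := isGautama_threeDblst.regular
  weak_star_regular := fun ⟨x⟩ => congrArg ULift.up
    ((by decide : ∀ x : Fin 3, let _ := threeDblstOps; prime (prime (pstar x)) = pstar x) x)
  l1 := fun ⟨x⟩ => congrArg ULift.up
    ((by decide : ∀ x : Fin 3, let _ := threeDblstOps;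
      pstar (prime (x ⊓ pstar (prime x))) = x ⊓ pstar (prime x)) x)

theorem isGautama_threeKlst : IsGautama threeKlst.{u} := by
  refine IsGautama.lift (A := { carrier := Fin 3, ops := threeKlstOps }) ?_
  let _ := threeKlstOps
  have hL : IsBoundedDistribLattice (Fin 3) := by
    constructor <;> (try unfold Below) <;> decide
  refine @IsGautama.mk (Fin 3) _ (@IsStoneAlgebra.mk _ _ hL ?_ ?_ ?_ ?_ ?_ ?_ ?_)
    (@IsDuallyQuasiDeMorgan.mk _ _ hL ?_ ?_ ?_ ?_ ?_) ?_ ?_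
  all_goals try unfold IsRegular
  all_goals try unfold Below
  all_goals decide

theorem isAlmostGautama_threeKlst : IsAlmostGautama threeKlst.{u} where
  stoneAlgebra := isGautama_threeKlst.stoneAlgebra
  duallyQuasiDeMorgan := isGautama_threeKlst.duallyQuasiDeMorgan
  regular := isGautama_threeKlst.regular
  weak_star_regular := fun ⟨x⟩ => congrArg ULift.up
    ((by decide : ∀ x : Fin 3, let _ := threeKlstOps; prime (prime (pstar x)) = pstar x) x)
  l1 := fun ⟨x⟩ => congrArg ULift.up
    ((by decide : ∀ x : Fin 3, let _ := threeKlstOps;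
      pstar (prime (x ⊓ pstar (prime x))) = x ⊓ pstar (prime x)) x)

/-- Regularity at (b, a) reads b ≤ a. Then b = b' = (b ∧ a)' = b' ∨ a' = 1, so 1 = b = b' = 0. -/
theorem bot_eq_top_of_isRegular {A : Type u} [Ops A] (hD : IsDuallyQuasiDeMorgan A)
    (hR : IsRegular A) {a b : A} (ha₁ : prime a = ⊤) (ha₂ : pstar a = ⊥) (hb₁ : prime b = b)
    (hb₂ : pstar b = ⊥) : (⊥ : A) = ⊤ := by
  have sup_bot : a ⊔ ⊥ = a := by
    rw [← hD.bot_below a, hD.inf_comm, hD.sup_inf_self]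
  have hba : b ⊓ a = b := by
    have h := hR b a
    rwa [hb₁, hb₂, hD.prime_bot, hD.below_top b, ha₂, sup_bot] at h
  have hb : b = b ⊔ ⊤ := by
    have h := hD.prime_inf b a
    rwa [hba, hb₁, ha₁] at h
  have hb_top : b = ⊤ := by
    have h := hD.inf_sup_self ⊤ b
    rw [hD.sup_comm, ← hb, hD.inf_comm] at h
    exact (hD.below_top b).symm.trans h
  rw [← hD.prime_top, ← hb_top, hb₁]

/-- Only axioms common to Gautama and almost Gautama algebras are used, so one argument serves both
classes. The elements a and b are the middle elements of the two chains. -/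
theorem not_embeddingProperty_of_isRegular {V : Set Alg.{u}}
    (hV : ∀ A ∈ V, IsDuallyQuasiDeMorgan A ∧ IsRegular A) (h₁ : threeDblst ∈ V)
    (h₂ : threeKlst ∈ V) : ¬ EmbeddingProperty V := by
  intro h
  obtain ⟨C, hC, hAC, hBC⟩ := h threeDblst threeKlst h₁ h₂ inferInstance inferInstance
  apply bot_ne_top_of_embeds threeDblst_bot_ne_top hAC
  obtain ⟨f, hf, -⟩ := hAC
  obtain ⟨g, hg, -⟩ := hBC
  let a : threeDblst.{u} := ⟨(1 : Fin 3)⟩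
  let b : threeKlst.{u} := ⟨(1 : Fin 3)⟩
  refine bot_eq_top_of_isRegular (hV C hC).1 (hV C hC).2 (a := f a) (b := g b) ?_ ?_ ?_ ?_
  · rw [← hf.map_prime, ← hf.map_top]; rfl
  · rw [← hf.map_pstar, ← hf.map_bot]; rfl
  · rw [← hg.map_prime]; rfl
  · rw [← hg.map_pstar, ← hg.map_bot]; rfl

end AlmostGautama

open AlmostGautama
theorem mainTheorem4 :
    (∀ V : Set Alg.{u},
      V ∈ ({varietyGen {two}, varietyGen {threeDblst}, varietyGen {threeKlst},
        varietyGen {fourDmba}} : Set (Set Alg.{u})) →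
      EmbeddingProperty V) ∧
    (∀ V : Set Alg.{u},
      V ∈ ({varietyG, varietyGen {threeDblst, fourDmba}, varietyGen {threeKlst, fourDmba},
        varietyAG} : Set (Set Alg.{u})) →
      ¬ EmbeddingProperty V) := by
  constructor
  · rintro V (rfl | rfl | rfl | rfl)
    exacts [embeddingProperty_varietyGen_singleton hasEqInd_two,
      embeddingProperty_varietyGen_singleton hasEqInd_threeDblst,
      embeddingProperty_varietyGen_singleton hasEqInd_threeKlst,
      embeddingProperty_varietyGen_singleton hasEqInd_fourDmba]
  · rintro V (rfl | rfl | rfl | rfl)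
    exacts [not_embeddingProperty_of_isRegular (fun _ h => ⟨h.duallyQuasiDeMorgan, h.regular⟩)
        isGautama_threeDblst isGautama_threeKlst,
      not_embeddingProperty_threeDblst_fourDmba, not_embeddingProperty_threeKlst_fourDmba,
      not_embeddingProperty_of_isRegular (fun _ h => ⟨h.duallyQuasiDeMorgan, h.regular⟩)
        isAlmostGautama_threeDblst isAlmostGautama_threeKlst]
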